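/- Let $G$ be a finite group, $\mathrm{Irr}(G)$ its set of irreducible complex characters, and let $S=(\mathcal X,\mathcal Y)$ be a supercharacter theory of $G$: $\mathcal X$ is a partition of $\mathrm{Irr}(G)$ and $\mathcal Y$ a partition of $G$ with $\{1\}\in\mathcal Y$ and $|\mathcal X|=|\mathcal Y|$, such that for every $X\in\mathcal X$ the character $\sigma_X=\sum_{\chi\in X}\chi(1)\chi$ is constant on each member of $\mathcal Y$. The members of $\mathcal Y$ are called $S$-classes, the characters $\sigma_X$ ($X\in\mathcal X$) are called $S$-characters, and $\mathrm{Irr}(S)$ is the set of $S$-characters. For a character $\chi$ put $\ker\chi=\{g\in G:\chi(g)=\chi(1)\}$. A subgroup of $G$ is $S$-normal if it is a union of $S$-classes, and $G$ is $S$-abelian if every $S$-class consists of a single element. For a subgroup $H\le G$ let $\mathrm{Irr}(S\mid H)=\{\chi\in\mathrm{Irr}(S): H\not\le\ker\chi\}$ and let $V(S\mid H)$ be the subgroup generated by all $g\in G$ such that $\chi(g)\neq 0$ for some $\chi\in\mathrm{Irr}(S\mid H)$. For an $S$-normal subgroup $N$ let $U(S\mid N)$ be the product of all $S$-normal subgroups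 $H$ of $G$ with $V(S\mid H)\le N$. Suppose that $G$ is not $S$-abelian. Then the following hold for every $S$-normal subgroup $N$ of $G$. 1. $U(S\mid N)$ is the unique largest subgroup $U\le G$ such that every character in $\mathrm{Irr}(S\mid U)$ vanishes on $G\setminus N$; that is, $U(S\mid N)$ has this property and contains every subgroup of $G$ that has it. 2. For every $g\in G$, we have $g\in U(S\mid N)$ if and only if every $\chi\in\mathrm{Irr}(S)$ with $g\notin\ker\chi$ vanishes on $G\setminus N$. -/

import Mathlib

noncomputable section

/-- `Irr(G)`: the set of ordinary irreducible characters of `G`, i.e. the trace functions of the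
irreducible complex representations of finite degree. (Every representation of degree `n` is
isomorphic to one on `ℂⁿ`, and isomorphic representations have the same character.) -/
def IrrChar (G : Type*) [Group G] : Set (G → ℂ) :=
  {χ | ∃ (n : ℕ) (ρ : Representation ℂ G (Fin n → ℂ)), ρ.IsIrreducible ∧ ρ.character = χ}

/-- A finite group has only finitely many irreducible characters (they are orthonormal), so the
sums over sets of irreducible characters below are genuine finite sums. -/
instance finite_irrChar (G : Type*) [Group G] [Finite G] : Finite (IrrChar G) := by
  classical
  have := Fintype.ofFinite G
  have hc : (Nat.card G : ℂ) ≠ 0 := by exact_mod_cast Nat.card_pos.ne'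
  letI : Invertible (Nat.card G : ℂ) := invertibleOfNonzero hc
  have horth : ∀ χ ψ : IrrChar G,
      (Nat.card G : ℂ)⁻¹ * ∑ g : G, χ.1 g * ψ.1 g⁻¹ = if χ = ψ then 1 else 0 := by
    rintro ⟨χ, n, ρ, hρ, rfl⟩ ⟨ψ, m, τ, hτ, rfl⟩
    have h := Representation.char_orthonormal ρ τ
    have h' := Representation.char_orthonormal ρ ρ
    rw [if_pos ⟨Representation.Equiv.refl ρ⟩] at h'
    split_ifs with he
    · have he' : ρ.character = τ.character := congrArg Subtype.val he
      simp only
      rw [← he']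
      exact h'
    · rw [if_neg] at h
      · exact h
      · rintro ⟨φ⟩
        exact he (Subtype.ext (Representation.char_iso φ).symm)
  have hli : LinearIndependent ℂ (fun χ : IrrChar G => χ.1) := by
    rw [linearIndependent_iff']
    intro s c hs ψ hψ
    have h1 : ∑ χ ∈ s, c χ * ((Nat.card G : ℂ)⁻¹ * ∑ g : G, χ.1 g * ψ.1 g⁻¹) = 0 := by
      have h2 : ∀ g : G, ∑ χ ∈ s, c χ * χ.1 g = 0 := by
        intro g
        have := congrFun hs g
        simpa using this
      calc _ = (Nat.card G : ℂ)⁻¹ * ∑ g : G, (∑ χ ∈ s, c χ * χ.1 g) * ψ.1 g⁻¹ := by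
            simp only [Finset.sum_mul, Finset.mul_sum]
            rw [Finset.sum_comm]
            refine Finset.sum_congr rfl fun g _ => Finset.sum_congr rfl fun χ _ => ?_
            ring
        _ = 0 := by simp [h2]
    simp only [horth] at h1
    simpa [hψ] using h1
  exact hli.finite

/-- The sum `σ_X = ∑_{χ ∈ X} χ(1) χ` attached to a set `X` of irreducible characters. -/
def sigmaChar {G : Type*} [Group G] (X : Set (IrrChar G)) : G → ℂ :=
  fun g => ∑ᶠ χ ∈ X, χ.1 1 * χ.1 g

/-- A supercharacter theory `S = (𝒳, 𝒴)` of a finite group `G`: a partition `𝒳` of `Irr(G)` and a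
partition `𝒴` of `G` with `{1} ∈ 𝒴` and `|𝒳| = |𝒴|` such that every `σ_X` (`X ∈ 𝒳`) is constant on
every member of `𝒴`. -/
structure SupercharacterTheory (G : Type*) [Group G] [Finite G] where
  /-- the partition `𝒳` of `Irr(G)` -/
  charParts : Set (Set (IrrChar G))
  /-- the partition `𝒴` of `G` into superclasses (`S`-classes) -/
  classes : Set (Set G)
  isPartition_charParts : Setoid.IsPartition charParts
  isPartition_classes : Setoid.IsPartition classes
  singleton_one_mem : {1} ∈ classes
  card_eq : Nat.card charParts = Nat.card classes
  sigma_const : ∀ X ∈ charParts, ∀ Y ∈ classes, ∀ g ∈ Y, ∀ h ∈ Y, sigmaChar X g = sigmaChar X h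

/-- The kernel `{g | χ(g) = χ(1)}` of a character `χ`. -/
def charKer {G : Type*} [Group G] (χ : G → ℂ) : Set G :=
  {g | χ g = χ 1}

namespace SupercharacterTheory

variable {G : Type*} [Group G] [Finite G] (S : SupercharacterTheory G)

/-- `Irr(S)`: the set of supercharacters (`S`-characters) `σ_X`, `X ∈ 𝒳`. -/
def irr : Set (G → ℂ) :=
  {χ | ∃ X ∈ S.charParts, χ = sigmaChar X}

/-- `Irr(S | H)`: the set of `S`-characters not containing `H` in their kernels. -/
def irrOver (H : Subgroup G) : Set (G → ℂ) :=
  {χ | χ ∈ S.irr ∧ ¬ (H : Set G) ⊆ charKer χ}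

/-- `Cl_S(g)`: the `S`-class containing `g`. -/
def cl (g : G) : Set G :=
  {h | ∃ K ∈ S.classes, g ∈ K ∧ h ∈ K}

/-- `Z(S)`, the set of elements whose `S`-class has exactly one element. -/
def center : Set G :=
  {g | (S.cl g).ncard = 1}

/-- `G` is `S`-abelian if `Z(S) = G`. -/
def IsAbelian : Prop :=
  S.center = Set.univ

/-- A subgroup is `S`-normal if it is a union of `S`-classes. -/
def IsNormal (N : Subgroup G) : Prop :=
  ∃ T ⊆ S.classes, (N : Set G) = ⋃₀ T

/-- `V(S | H)`: the subgroup generated by the elements `g` such that `χ(g) ≠ 0` for some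
`χ ∈ Irr(S | H)`. -/
def vanishingOff (H : Subgroup G) : Subgroup G :=
  Subgroup.closure {g | ∃ χ ∈ S.irrOver H, χ g ≠ 0}

/-- `U(S | N)`: the product of all `S`-normal subgroups `H` with `V(S | H) ≤ N`. As `S`-normal
subgroups are normal, their product is the subgroup they generate, i.e. their join. -/
def upperVanishing (N : Subgroup G) : Subgroup G :=
  sSup {H : Subgroup G | S.IsNormal H ∧ S.vanishingOff H ≤ N}

end SupercharacterTheory

end

/-!
The kernel of an `S`-character `σ_X` is an `S`-normal subgroup. It is a subgroup because a sum of
eigenvalues of absolute value one has real part at most the number of summands, with equality only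
when all of them are `1`: hence `σ_X(g) = σ_X(1)` forces `g` to act trivially in every
representation affording a member of `X` (`coe_sigmaKer`). It is a union of `S`-classes because
`σ_X` is constant on them.

Consequently the intersection of the kernels of all `S`-characters whose kernel contains a given
subgroup `U` is an `S`-normal subgroup `normalHull U ⊇ U`, and `U` and `normalHull U` lie in the
same kernels, so `Irr(S | U) = Irr(S | normalHull U)`. As `V(S | U) ≤ N` says exactly that the
members of `Irr(S | U)` vanish off `N` (`vanishingOff_le_iff`), every `U` with this property is
contained in an `S`-normal one. The join of subgroups with the property has it again, since a kernel
that contains each of them contains their join. The elementwise criterion is the case of the cyclic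
subgroup generated by `g`.
-/

/-! ### Traces of linear maps of finite order -/

theorem Multiset.re_sum_le_card {s : Multiset ℂ} (hs : ∀ z ∈ s, ‖z‖ = 1) :
    s.sum.re ≤ s.card := by
  induction s using Multiset.induction_on with
  | empty => simp
  | cons a s ih =>
    have h1 := ih fun z hz => hs z (Multiset.mem_cons_of_mem hz)
    have h2 := (Complex.re_le_norm a).trans_eq (hs a (Multiset.mem_cons_self a s))
    simp only [Multiset.sum_cons, Complex.add_re, Multiset.card_cons, Nat.cast_add, Nat.cast_one]
    linarith

theorem Multiset.eq_one_of_re_sum_eq_card {s : Multiset ℂ} (hs : ∀ z ∈ s, ‖z‖ = 1)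
    (h : s.sum.re = s.card) : ∀ z ∈ s, z = 1 := by
  intro z hz
  obtain ⟨t, rfl⟩ := Multiset.exists_cons_of_mem hz
  have h1 := Multiset.re_sum_le_card fun w hw => hs w (Multiset.mem_cons_of_mem hw)
  have hz1 := hs z hz
  have h2 := (Complex.re_le_norm z).trans_eq hz1
  simp only [Multiset.sum_cons, Complex.add_re, Multiset.card_cons, Nat.cast_add,
    Nat.cast_one] at h
  have hre : z.re = 1 := by linarith
  have him : z.im = 0 := by
    have := Complex.sq_norm z
    rw [Complex.normSq_apply, hz1, hre] at this
    nlinarith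
  exact Complex.ext hre him

section LinearMap

variable {V : Type*} [AddCommGroup V] [Module ℂ V] [FiniteDimensional ℂ V]
  {f : Module.End ℂ V} {m : ℕ}

theorem Module.End.norm_eq_one_of_mem_roots_charpoly (hm : m ≠ 0) (hf : f ^ m = 1) {z : ℂ}
    (hz : z ∈ f.charpoly.roots) : ‖z‖ = 1 := by
  have he : f.HasEigenvalue z :=
    (Module.End.hasEigenvalue_iff_isRoot_charpoly f z).2 (Polynomial.isRoot_of_mem_roots hz)
  obtain ⟨v, hv⟩ := he.exists_hasEigenvector
  have h1 := hv.pow_apply m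
  rw [hf, Module.End.one_apply] at h1
  have h2 : (z ^ m - 1) • v = 0 := by rw [sub_smul, one_smul, ← h1, sub_self]
  have h3 := (smul_eq_zero.1 h2).resolve_right hv.2
  exact Complex.norm_eq_one_of_pow_eq_one (sub_eq_zero.1 h3) hm

theorem Module.End.trace_eq_sum_roots (f : Module.End ℂ V) :
    LinearMap.trace ℂ V f = f.charpoly.roots.sum :=
  Module.End.trace_eq_sum_roots_charpoly_of_splits (IsAlgClosed.splits _)

theorem Module.End.card_roots_charpoly (f : Module.End ℂ V) :
    f.charpoly.roots.card = Module.finrank ℂ V := by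
  rw [← LinearMap.charpoly_natDegree f]
  exact ((IsAlgClosed.splits f.charpoly).natDegree_eq_card_roots).symm

theorem Module.End.re_trace_le_finrank (hm : m ≠ 0) (hf : f ^ m = 1) :
    (LinearMap.trace ℂ V f).re ≤ Module.finrank ℂ V := by
  rw [Module.End.trace_eq_sum_roots, ← Module.End.card_roots_charpoly f]
  exact Multiset.re_sum_le_card fun z hz => Module.End.norm_eq_one_of_mem_roots_charpoly hm hf hz

/-- The equality case of `Module.End.re_trace_le_finrank`: all eigenvalues are `1`, and a linear
map of finite order over `ℂ` is diagonalizable. -/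
theorem Module.End.eq_one_of_re_trace_eq_finrank (hm : m ≠ 0) (hf : f ^ m = 1)
    (h : (LinearMap.trace ℂ V f).re = Module.finrank ℂ V) : f = 1 := by
  rw [Module.End.trace_eq_sum_roots, ← Module.End.card_roots_charpoly f] at h
  have h1 := Multiset.eq_one_of_re_sum_eq_card
    (fun z hz => Module.End.norm_eq_one_of_mem_roots_charpoly hm hf hz) h
  have hss : f.IsSemisimple := by
    have hsep : (Polynomial.X ^ m - 1 : Polynomial ℂ).Separable :=
      (Polynomial.X_pow_sub_one_separable_iff).2 (by exact_mod_cast hm)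
    refine Module.End.isSemisimple_of_squarefree_aeval_eq_zero hsep.squarefree ?_
    simp [hf]
  have htop := Module.End.iSup_maxGenEigenspace_eq_top f
  have hle : (⨆ μ, f.maxGenEigenspace μ) ≤ f.eigenspace 1 := by
    refine iSup_le fun μ => ?_
    rw [hss.isFinitelySemisimple.maxGenEigenspace_eq_eigenspace]
    by_cases hμ : f.HasEigenvalue μ
    · rw [h1 μ ((Polynomial.mem_roots f.charpoly_monic.ne_zero).2
        ((Module.End.hasEigenvalue_iff_isRoot_charpoly f μ).1 hμ))]
    · rw [Module.End.hasEigenvalue_iff, not_not] at hμ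
      rw [hμ]
      exact bot_le
  rw [htop] at hle
  ext v
  simpa using Module.End.mem_eigenspace_iff.1 (hle (Submodule.mem_top (x := v)))

end LinearMap

/-! ### Kernels of supercharacters -/

section Kernels

variable {G : Type*} [Group G]

theorem Representation.apply_pow_card [Finite G] {V : Type*} [AddCommGroup V] [Module ℂ V]
    (ρ : Representation ℂ G V) (g : G) : ρ g ^ Nat.card G = 1 := by
  rw [← map_pow, pow_card_eq_one', map_one]

theorem Representation.apply_eq_one_of_re_character [Finite G] {V : Type*} [AddCommGroup V]
    [Module ℂ V] [FiniteDimensional ℂ V] (ρ : Representation ℂ G V) {g : G}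
    (h : (ρ.character g).re = (ρ.character 1).re) : ρ g = 1 := by
  refine Module.End.eq_one_of_re_trace_eq_finrank Nat.card_pos.ne' (ρ.apply_pow_card g) ?_
  rw [ρ.char_one, Complex.natCast_re] at h
  exact h

namespace IrrChar

variable {χ : G → ℂ}

theorem exists_pos_eq_one (hχ : χ ∈ IrrChar G) : ∃ n : ℕ, 0 < n ∧ χ 1 = n := by
  obtain ⟨n, ρ, hρ, rfl⟩ := hχ
  have : Nontrivial (Fin n → ℂ) := IsSimpleModule.nontrivial (MonoidAlgebra ℂ G) ρ.asModule
  exact ⟨n, by simpa using Module.finrank_pos (R := ℂ) (M := Fin n → ℂ), by simp [ρ.char_one]⟩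

variable [Finite G]

theorem re_le (hχ : χ ∈ IrrChar G) (g : G) : (χ g).re ≤ (χ 1).re := by
  obtain ⟨n, ρ, -, rfl⟩ := hχ
  rw [ρ.char_one, Complex.natCast_re]
  exact Module.End.re_trace_le_finrank Nat.card_pos.ne' (ρ.apply_pow_card g)

theorem mem_charKer_of_re (hχ : χ ∈ IrrChar G) {g : G} (h : (χ g).re = (χ 1).re) :
    g ∈ charKer χ := by
  obtain ⟨n, ρ, -, rfl⟩ := hχ
  have h1 := ρ.apply_eq_one_of_re_character h
  simp only [charKer, Set.mem_ofPred_eq, Representation.character, h1, map_one]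

theorem mul_mem_charKer (hχ : χ ∈ IrrChar G) {a b : G} (ha : a ∈ charKer χ)
    (hb : b ∈ charKer χ) : a * b ∈ charKer χ := by
  obtain ⟨n, ρ, -, rfl⟩ := hχ
  have h1 := ρ.apply_eq_one_of_re_character (congrArg Complex.re ha)
  have h2 := ρ.apply_eq_one_of_re_character (congrArg Complex.re hb)
  simp only [charKer, Set.mem_ofPred_eq, Representation.character, map_mul, h1, h2, mul_one,
    map_one]

theorem inv_mem_charKer (hχ : χ ∈ IrrChar G) {a : G} (ha : a ∈ charKer χ) :
    a⁻¹ ∈ charKer χ := by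
  obtain ⟨n, ρ, -, rfl⟩ := hχ
  have h1 := ρ.apply_eq_one_of_re_character (congrArg Complex.re ha)
  have h2 : ρ a⁻¹ = 1 := by
    have := map_mul ρ a⁻¹ a
    rwa [inv_mul_cancel, map_one, h1, mul_one, eq_comm] at this
  simp only [charKer, Set.mem_ofPred_eq, Representation.character, h2, map_one]

end IrrChar

/-- The intersection of the kernels of the members of `X`, as a subgroup. -/
def sigmaKer [Finite G] (X : Set (IrrChar G)) : Subgroup G where
  carrier := {g | ∀ χ ∈ X, g ∈ charKer χ.1}
  one_mem' := fun _ _ => rfl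
  mul_mem' := fun ha hb χ hχ => IrrChar.mul_mem_charKer χ.2 (ha χ hχ) (hb χ hχ)
  inv_mem' := fun ha χ hχ => IrrChar.inv_mem_charKer χ.2 (ha χ hχ)

/-- The kernel of `σ_X` is the intersection of the kernels of the members of `X`; in particular it
is a subgroup. -/
theorem coe_sigmaKer [Finite G] (X : Set (IrrChar G)) :
    (sigmaKer X : Set G) = charKer (sigmaChar X) := by
  classical
  have := Fintype.ofFinite (IrrChar G)
  have hsum : ∀ g, sigmaChar X g = ∑ χ ∈ X.toFinset, χ.1 1 * χ.1 g := fun g => by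
    rw [sigmaChar, finsum_mem_eq_toFinset_sum]
  ext g
  change (∀ χ ∈ X, g ∈ charKer χ.1) ↔ sigmaChar X g = sigmaChar X 1
  rw [hsum, hsum]
  constructor
  · intro h
    refine Finset.sum_congr rfl fun χ hχ => ?_
    rw [show χ.1 g = χ.1 1 from h χ (Set.mem_toFinset.1 hχ)]
  · intro h χ hχ
    -- Compare real parts termwise: each summand is largest at `1`, so equality
    -- of the sums forces equality of every summand.
    have hle : ∀ ψ ∈ X.toFinset, (ψ.1 1 * ψ.1 g).re ≤ (ψ.1 1 * ψ.1 1).re := fun ψ _ => by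
      obtain ⟨n, -, hn⟩ := IrrChar.exists_pos_eq_one ψ.2
      have hψ := IrrChar.re_le ψ.2 g
      rw [hn] at hψ ⊢
      rw [← nsmul_eq_mul, ← nsmul_eq_mul, Complex.re_nsmul, Complex.re_nsmul, nsmul_eq_mul,
        nsmul_eq_mul]
      exact mul_le_mul_of_nonneg_left hψ (Nat.cast_nonneg n)
    have hre := congrArg Complex.re h
    rw [Complex.re_sum, Complex.re_sum] at hre
    have heq := (Finset.sum_eq_sum_iff_of_le hle).1 hre χ (Set.mem_toFinset.2 hχ)
    obtain ⟨n, hpos, hn⟩ := IrrChar.exists_pos_eq_one χ.2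
    refine IrrChar.mem_charKer_of_re χ.2 ?_
    rw [hn] at heq ⊢
    rw [← nsmul_eq_mul, ← nsmul_eq_mul, Complex.re_nsmul, Complex.re_nsmul, nsmul_eq_mul,
        nsmul_eq_mul] at heq
    exact mul_left_cancel₀ (by exact_mod_cast hpos.ne') heq

end Kernels

/-! ### The subgroups `U(S | N)` -/

namespace SupercharacterTheory

variable {G : Type*} [Group G] [Finite G] (S : SupercharacterTheory G)

variable {S} in
theorem exists_subgroup_eq_charKer {χ : G → ℂ} (hχ : χ ∈ S.irr) :
    ∃ K : Subgroup G, (K : Set G) = charKer χ := by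
  obtain ⟨X, -, rfl⟩ := hχ
  exact ⟨sigmaKer X, coe_sigmaKer X⟩

theorem isNormal_of_forall_subset {N : Subgroup G}
    (h : ∀ Y ∈ S.classes, ∀ g ∈ Y, g ∈ N → Y ⊆ N) : S.IsNormal N := by
  refine ⟨{Y | Y ∈ S.classes ∧ Y ⊆ N}, fun Y hY => hY.1, Set.Subset.antisymm (fun g hg => ?_) ?_⟩
  · obtain ⟨Y, ⟨hY, hgY⟩, -⟩ := S.isPartition_classes.2 g
    exact ⟨Y, ⟨hY, h Y hY g hgY hg⟩, hgY⟩
  · exact Set.sUnion_subset fun Y hY => hY.2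

/-- The intersection of all kernels of `S`-characters that contain `U`. -/
def normalHull (U : Subgroup G) : Subgroup G :=
  sInf {K | (∃ χ ∈ S.irr, (K : Set G) = charKer χ) ∧ U ≤ K}

theorem le_normalHull (U : Subgroup G) : U ≤ S.normalHull U :=
  le_sInf fun _ hK => hK.2

theorem isNormal_normalHull (U : Subgroup G) : S.IsNormal (S.normalHull U) := by
  refine S.isNormal_of_forall_subset fun Y hY g hgY hg h hhY => ?_
  refine Subgroup.mem_sInf.2 ?_
  rintro K ⟨⟨χ, hχ, hK⟩, hUK⟩
  have hgK : g ∈ (K : Set G) := Subgroup.mem_sInf.1 hg K ⟨⟨χ, hχ, hK⟩, hUK⟩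
  change h ∈ (K : Set G)
  rw [hK] at hgK ⊢
  obtain ⟨X, hX, rfl⟩ := hχ
  exact (S.sigma_const X hX Y hY h hhY g hgY).trans hgK

theorem irrOver_normalHull (U : Subgroup G) : S.irrOver (S.normalHull U) = S.irrOver U := by
  ext χ
  refine and_congr_right fun hχ => not_congr
    ⟨(SetLike.coe_subset_coe.2 (S.le_normalHull U)).trans, fun h => ?_⟩
  obtain ⟨K, hK⟩ := exists_subgroup_eq_charKer hχ
  rw [← hK] at h ⊢
  exact sInf_le (a := K) ⟨⟨χ, hχ, hK⟩, h⟩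

theorem vanishingOff_le_iff {U N : Subgroup G} :
    S.vanishingOff U ≤ N ↔ ∀ χ ∈ S.irrOver U, ∀ x : G, x ∉ N → χ x = 0 := by
  rw [vanishingOff, Subgroup.closure_le]
  constructor
  · intro h χ hχ x hx
    by_contra hne
    exact hx (h ⟨χ, hχ, hne⟩)
  · rintro h x ⟨χ, hχ, hne⟩
    by_contra hx
    exact hne (h χ hχ x hx)

theorem le_upperVanishing {U N : Subgroup G}
    (hU : ∀ χ ∈ S.irrOver U, ∀ x : G, x ∉ N → χ x = 0) : U ≤ S.upperVanishing N := by
  refine (S.le_normalHull U).trans (le_sSup ⟨S.isNormal_normalHull U, ?_⟩)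
  rw [vanishingOff_le_iff, irrOver_normalHull]
  exact hU

theorem eq_zero_of_mem_irrOver_upperVanishing {N : Subgroup G} {χ : G → ℂ}
    (hχ : χ ∈ S.irrOver (S.upperVanishing N)) {x : G} (hx : x ∉ N) : χ x = 0 := by
  obtain ⟨K, hK⟩ := exists_subgroup_eq_charKer hχ.1
  by_contra hne
  refine hχ.2 ?_
  rw [← hK]
  refine sSup_le (a := K) fun H hH => ?_
  by_contra hHK
  refine hne (S.vanishingOff_le_iff.1 hH.2 χ ⟨hχ.1, ?_⟩ x hx)
  rw [← hK]
  exact hHK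

theorem isGreatest_upperVanishing (N : Subgroup G) :
    IsGreatest {U : Subgroup G | ∀ χ ∈ S.irrOver U, ∀ x : G, x ∉ N → χ x = 0}
      (S.upperVanishing N) :=
  ⟨fun _ hχ _ hx => S.eq_zero_of_mem_irrOver_upperVanishing hχ hx,
    fun _ hU => S.le_upperVanishing hU⟩

theorem mem_upperVanishing_iff (N : Subgroup G) (g : G) :
    g ∈ S.upperVanishing N ↔
      ∀ χ ∈ S.irr, g ∉ charKer χ → ∀ x : G, x ∉ N → χ x = 0 := by
  constructor
  · exact fun hg χ hχ hgχ x hx =>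
      S.eq_zero_of_mem_irrOver_upperVanishing ⟨hχ, fun hle => hgχ (hle hg)⟩ hx
  · intro h
    refine S.le_upperVanishing (U := Subgroup.zpowers g) ?_ (Subgroup.mem_zpowers g)
    rintro χ ⟨hχ, hle⟩
    refine h χ hχ fun hg => hle ?_
    obtain ⟨K, hK⟩ := exists_subgroup_eq_charKer hχ
    rw [← hK] at hg ⊢
    exact Subgroup.zpowers_le.2 hg

end SupercharacterTheory

theorem theorem2 {G : Type*} [Group G] [Finite G] (S : SupercharacterTheory G)
    (hS : ¬ S.IsAbelian) :
    (∀ N : Subgroup G, S.IsNormal N →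
      IsGreatest {U : Subgroup G | ∀ χ ∈ S.irrOver U, ∀ x : G, x ∉ N → χ x = 0}
        (S.upperVanishing N)) ∧
    (∀ N : Subgroup G, S.IsNormal N → ∀ g : G,
      (g ∈ S.upperVanishing N ↔
        ∀ χ ∈ S.irr, g ∉ charKer χ → ∀ x : G, x ∉ N → χ x = 0)) :=
  ⟨fun N _ => S.isGreatest_upperVanishing N, fun N _ g => S.mem_upperVanishing_iff N g⟩
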